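/- Let $\mathcal M$ be a complete smooth Riemannian manifold of dimension $m$, in which for any $a,b\in\mathcal M$ a (not necessarily unique) shortest geodesic $g(\cdot;a,b)\colon\mathbb R\to\mathcal M$ with $g(0;a,b)=a$, $g(1;a,b)=b$ has been chosen. For points $y_0,\dots,y_K\in\mathcal M$ the Bézier curve $\beta_K(t;y_0,\dots,y_K)=x_0^{[K]}$ is given by the De Casteljau algorithm $x_l^{[0]}=y_l$, $x_l^{[k]}=g(t;x_l^{[k-1]},x_{l+1}^{[k-1]})$. Let $K\ge 3$ and let $B\colon[0,n]\to\mathcal M$ be the continuous composite Bézier curve with $n$ segments of degree $K$, with junction points $p_0,\dots,p_n$ and inner control points $b^i_j$ ($0\le i<n$, $1\le j\le K-1$): with $b_0^i=p_i$ and $b_K^i=p_{i+1}$, $$B(t)=\beta_K(t-i;\,b_0^i,b_1^i,\dots,b_{K-1}^i,b_K^i)\qquad\text{for } t\in(i,i+1],\ 0\le i<n,$$ the interval being $[0,1]$ for $i=0$. Put $b_i^-=b^{i-1}_{K-1}$ and $b_i^+=b_1^i$. Enforce the $C^1$ condition by replacing $b_i^+$ by $g(2;b_i^-,p_i)$ for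 $i=1,\dots,n-1$, and call the resulting curve $\tilde B$; below, $b_i^+$ stands for this value. Fix $t\in[0,n]$, and suppose that $(a,b)\mapsto g(2;a,b)$ is differentiable at $(b_i^-,p_i)$ for $1\le i\le n-1$, and that, with $s$ the local parameter of $t$ in its segment ($s=t-i$ for $t\in(i,i+1]$, and $s=0$ for $t=0$), $(a,b)\mapsto g(s;a,b)$ is differentiable at each of the pairs $(x_l^{[k]},x_{l+1}^{[k]})$, $k+l<K$, that the De Casteljau algorithm for $\tilde B(t)$ meets. Write $D_xF[\eta]$ for the differential of $F$ with respect to its argument $x$ in the direction $\eta$ (the other arguments being fixed). Then the differentials of the Bézier segment to which $t$ belongs, with respect to each of its $K+1$ control points, exist, and so do all of the following differentials of $\tilde B(t)$; moreover: 1. $\tilde B(t)$ does not depend on the variables $b_i^+$, $1\le i\le n-1$. 2. For $1\le i\le n-1$ and $\eta\in T_{b_i^-}\mathcal M$, $$D_{b_i^-}\tilde B(t)[\eta]=\begin{cases}D_{b_i^-}\beta_K(t-i+1;\,p_{i-1},b_{i-1}^+,\dots,b_i^-,p_i)[\eta], & t\in(i-1,i],\\ D_{b_i^+}\beta_K(t-i;\,p_i,b_i^+,\dots,b_{i+1}^-,p_{i+1})\bigl[D_{b_i^-}g(2;b_i^-,p_i)[\eta]\bigr],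 & t\in(i,i+1],\\ 0,&\text{otherwise.}\end{cases}$$ 3. For $1\le i\le n-1$ and $\eta\in T_{p_i}\mathcal M$, $$D_{p_i}\tilde B(t)[\eta]=\begin{cases}D_{p_i}\beta_K(t-i+1;\,p_{i-1},b_{i-1}^+,\dots,b_i^-,p_i)[\eta], & t\in(i-1,i],\\ D_{p_i}\beta_K(t-i;\,p_i,b_i^+,\dots,b_{i+1}^-,p_{i+1})[\eta]+D_{b_i^+}\beta_K(t-i;\,p_i,b_i^+,\dots,b_{i+1}^-,p_{i+1})\bigl[D_{p_i}g(2;b_i^-,p_i)[\eta]\bigr], & t\in(i,i+1],\\ 0,&\text{otherwise.}\end{cases}$$ 4. With respect to every other control point $x$ (not a $b_i^+$, $b_i^-$ or $p_i$ with $1\le i\le n-1$), $D_x\tilde B(t)$ equals the differential $D_xB(t)$ of the unconstrained composite curve, taken at the control points with $b_i^+=g(2;b_i^-,p_i)$. In 2 and 3 all differentials of $\beta_K$ are partial ones in the named control point, the first interval includes $t=0$ when $i=1$, and $b_0^+=b_1^0$, $b_n^-=b_{K-1}^{n-1}$ are the free control points of the first and last segment. -/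

import Mathlib

open Set Manifold ContDiff Bundle

/-- `γ` is a shortest geodesic from `a` to `b` (parametrized over the whole real line), in a
Riemannian manifold whose metric-space distance is the Riemannian distance: it has constant
speed `dist a b`, is locally distance-minimizing everywhere (i.e. it is a geodesic), and is
distance-minimizing between `γ 0 = a` and `γ 1 = b`. -/
structure IsShortestGeodesic {M : Type*} [MetricSpace M] (a b : M) (γ : ℝ → M) : Prop where
  start : γ 0 = a
  finish : γ 1 = b
  minimizing : ∀ s ∈ Icc (0 : ℝ) 1, ∀ s' ∈ Icc (0 : ℝ) 1,
    dist (γ s) (γ s') = |s - s'| * dist a b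
  geodesic : ∀ t : ℝ, ∃ ε > 0, ∀ s ∈ Ioo (t - ε) (t + ε), ∀ s' ∈ Ioo (t - ε) (t + ε),
    dist (γ s) (γ s') = |s - s'| * dist a b

/-- The points `x_l^{[k]}` of the De Casteljau algorithm at time `t`, for the control points
`y 0, y 1, …` and the geodesics `g t a b = g(t; a, b)`. -/
def deCasteljau {M : Type*} (g : ℝ → M → M → M) (t : ℝ) (y : ℕ → M) : ℕ → ℕ → M
  | 0, l => y l
  | k + 1, l => g t (deCasteljau g t y k l) (deCasteljau g t y k (l + 1))

/-- The Bézier curve `β_K(t; y 0, …, y K)`. -/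
def bezier {M : Type*} (g : ℝ → M → M → M) (K : ℕ) (t : ℝ) (y : ℕ → M) : M :=
  deCasteljau g t y K 0

/-- Names of the control points of a continuous composite Bézier curve with segments of degree `K`:
`node i` is the junction point `p_i`, and `inner i j` is the control point `b_j^i`
of segment `i`, `1 ≤ j ≤ K - 1`. On `[0, n]` only `node i` with `i ≤ n` and `inner i j` with
`i < n`, `1 ≤ j ≤ K - 1` enter. -/
inductive CtrlLabel : Type
  | node (i : ℕ) : CtrlLabel
  | inner (i j : ℕ) : CtrlLabel
  deriving DecidableEq

namespace CtrlLabel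

/-- `b_i^+ = b_1^i`, the second control point of the segment that starts at `p_i`. -/
abbrev plus (i : ℕ) : CtrlLabel := inner i 1

/-- `b_i^- = b_{K-1}^{i-1}` (for `1 ≤ i`), the last but one control point of the segment that
ends at `p_i`. -/
abbrev minus (K i : ℕ) : CtrlLabel := inner (i - 1) (K - 1)

end CtrlLabel

/-- The control points `b_0^i = p_i, b_1^i, …, b_{K-1}^i, b_K^i = p_{i+1}` of segment `i`. -/
def segmentPoints {M : Type*} (K : ℕ) (c : CtrlLabel → M) (i : ℕ) : ℕ → M := fun j =>
  if j = 0 then c (.node i) else if j = K then c (.node (i + 1)) else c (.inner i j)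

/-- The number of the segment to which `t ≥ 0` belongs: `0` for `t ∈ [0, 1]`, and `i` for
`t ∈ (i, i + 1]`. -/
noncomputable def segmentIndex (t : ℝ) : ℕ := ⌈t⌉₊ - 1

/-- The composite Bézier curve with control points `c`. -/
noncomputable def compositeBezier {M : Type*} (g : ℝ → M → M → M) (K : ℕ)
    (c : CtrlLabel → M) (t : ℝ) : M :=
  bezier g K (t - segmentIndex t) (segmentPoints K c (segmentIndex t))

/-- Replace `b_i^+` by `g(2; b_i^-, p_i)` for `1 ≤ i ≤ n - 1`. -/
def enforceC1 {M : Type*} (g : ℝ → M → M → M) (n K : ℕ) (c : CtrlLabel → M) : CtrlLabel → M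
  | .node i => c (.node i)
  | .inner i j =>
      if 1 ≤ i ∧ i < n ∧ j = 1 then g 2 (c (.minus K i)) (c (.node i)) else c (.inner i j)

/-- The composite Bézier curve with `n` segments in which `b_i^+` is replaced by
`g(2; b_i^-, p_i)`. -/
noncomputable def compositeBezierC1 {M : Type*} (g : ℝ → M → M → M) (n K : ℕ)
    (c : CtrlLabel → M) (t : ℝ) : M :=
  compositeBezier g K (enforceC1 g n K c) t

/-- The differential `D_x F` at `c` of a function `F` of several points of `M`, with respect to
its argument with name `x`, the other arguments being fixed. -/
noncomputable def partialDiff {m : ℕ} {M : Type*} [TopologicalSpace M]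
    [ChartedSpace (EuclideanSpace ℝ (Fin m)) M] {ι : Type*} [DecidableEq ι]
    (F : (ι → M) → M) (c : ι → M) (x : ι) :
    TangentSpace (𝓡 m) (c x) →L[ℝ] TangentSpace (𝓡 m) (F c) :=
  mfderiv (𝓡 m) (𝓡 m) (fun z : M => F (Function.update c x z)) (c x)

/-- `F` is differentiable at `c` with respect to its argument with name `x`, with differential
`D_x F = D`. -/
def HasPartialDiffAt {m : ℕ} {M : Type*} [TopologicalSpace M]
    [ChartedSpace (EuclideanSpace ℝ (Fin m)) M] {ι : Type*} [DecidableEq ι]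
    (F : (ι → M) → M) (c : ι → M) (x : ι)
    (D : TangentSpace (𝓡 m) (c x) →L[ℝ] TangentSpace (𝓡 m) (F c)) : Prop :=
  HasMFDerivAt (𝓡 m) (𝓡 m) (fun z : M => F (Function.update c x z)) (c x) D

/-! For fixed `t` only the segment containing `t` matters, so $\tilde B(t)$ is one Bézier curve
evaluated at the points obtained from `c` by the substitution `enforceC1`. Moving $b_i^-$ moves the
substituted family in two places, $b_i^-$ (segment $i-1$) and $b_i^+$ (segment $i$), of which each
segment sees at most one. Moving $p_i$ moves $p_i$, shared by both segments, and $b_i^+$. This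
bookkeeping is carried by the lemmas `enforceC1_update_*` and `segmentPoints_update_*`.

Segment $i$ therefore sees two moving points when $p_i$ moves, and the sum formula needs joint
differentiability in both. This comes from the De Casteljau recursion, differentiated along an
arbitrary parameter manifold (`mdifferentiableAt_bezier`); `hasMFDerivAt_update_update` then splits
the differential. -/

/-! ### Transport of differentials and the chain rule for two linked arguments. -/

section Differentials

variable {m : ℕ} {M : Type*} [TopologicalSpace M] [ChartedSpace (EuclideanSpace ℝ (Fin m)) M]

/-- Typing `D` on the model space, to which every tangent space unfolds, lets the base point be
replaced by an equal one without a cast. -/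
theorem HasMFDerivAt.congr_base {f f' : M → M} {x x' : M}
    {D : EuclideanSpace ℝ (Fin m) →L[ℝ] EuclideanSpace ℝ (Fin m)}
    (h : HasMFDerivAt (𝓡 m) (𝓡 m) f x D) (hf : f = f') (hx : x = x') :
    HasMFDerivAt (𝓡 m) (𝓡 m) f' x' D := by
  subst hf hx
  exact h

theorem mfderiv_congr_fun {f f' : M → M} (h : f = f') (x : M) :
    (mfderiv (𝓡 m) (𝓡 m) f x : EuclideanSpace ℝ (Fin m) →L[ℝ] EuclideanSpace ℝ (Fin m)) =
      mfderiv (𝓡 m) (𝓡 m) f' x := by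
  rw [h]

/-- Chain rule for a function of several points, one of which follows another one. -/
theorem hasMFDerivAt_update_update {ι : Type*} [DecidableEq ι] {F : (ι → M) → M} {y : ι → M}
    {a b : ι} (hab : a ≠ b)
    (hF : MDifferentiableAt ((𝓡 m).prod (𝓡 m)) (𝓡 m)
      (fun q : M × M => F (Function.update (Function.update y a q.1) b q.2)) (y a, y b))
    {h : M → M} (hh : MDifferentiableAt (𝓡 m) (𝓡 m) h (y a)) (hy : h (y a) = y b) :
    ∃ D : EuclideanSpace ℝ (Fin m) →L[ℝ] EuclideanSpace ℝ (Fin m),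
      HasMFDerivAt (𝓡 m) (𝓡 m)
        (fun z : M => F (Function.update (Function.update y a z) b (h z))) (y a) D ∧
      ∀ η : EuclideanSpace ℝ (Fin m),
        D η = partialDiff (m := m) F y a η +
          partialDiff (m := m) F y b (mfderiv (𝓡 m) (𝓡 m) h (y a) η) := by
  let B : EuclideanSpace ℝ (Fin m) →L[ℝ] EuclideanSpace ℝ (Fin m) :=
    mfderiv (𝓡 m) (𝓡 m) h (y a)
  let A : EuclideanSpace ℝ (Fin m) × EuclideanSpace ℝ (Fin m) →L[ℝ] EuclideanSpace ℝ (Fin m) :=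
    mfderiv ((𝓡 m).prod (𝓡 m)) (𝓡 m)
      (fun q : M × M => F (Function.update (Function.update y a q.1) b q.2)) (y a, y b)
  have hp : HasMFDerivAt (𝓡 m) ((𝓡 m).prod (𝓡 m)) (fun z : M => (z, h z)) (y a)
      ((ContinuousLinearMap.id ℝ (EuclideanSpace ℝ (Fin m))).prod B) :=
    (hasMFDerivAt_id (y a)).prodMk hh.hasMFDerivAt
  have hA : HasMFDerivAt ((𝓡 m).prod (𝓡 m)) (𝓡 m)
      (fun q : M × M => F (Function.update (Function.update y a q.1) b q.2)) (y a, h (y a)) A := by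
    rw [hy]
    exact hF.hasMFDerivAt
  refine ⟨A.comp ((ContinuousLinearMap.id ℝ (EuclideanSpace ℝ (Fin m))).prod B),
    HasMFDerivAt.comp (y a) (f := fun z : M => (z, h z)) hA hp, fun η => ?_⟩
  -- Each partial map of the pair function freezes the other slot at its own value in `y`, so that
  -- update is trivial.
  have e1 : (fun z : M => F (Function.update (Function.update y a z) b (y b)))
      = fun z : M => F (Function.update y a z) := by
    funext z
    rw [Function.update_comm hab, Function.update_eq_self]
  have e2 : (fun z : M => F (Function.update (Function.update y a (y a)) b z))
      = fun z : M => F (Function.update y b z) := by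
    funext z
    rw [Function.update_eq_self]
  exact (mfderiv_prod_eq_add_apply hF (v := (η, B η))).trans (congrArg₂ (· + ·)
    (DFunLike.congr_fun (mfderiv_congr_fun e1 (y a)) η)
    (DFunLike.congr_fun (mfderiv_congr_fun e2 (y b)) (B η)))

end Differentials

/-! ### Differentiability of the De Casteljau algorithm. -/

section DeCasteljau

variable {E H E' H' N M : Type*} [NormedAddCommGroup E] [NormedSpace ℝ E] [TopologicalSpace H]
  {I : ModelWithCorners ℝ E H} [NormedAddCommGroup E'] [NormedSpace ℝ E'] [TopologicalSpace H']
  {J : ModelWithCorners ℝ E' H'} [TopologicalSpace N] [ChartedSpace H N]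
  [TopologicalSpace M] [ChartedSpace H' M]

/-- If the control points depend differentiably on a parameter, so do all points of the
De Casteljau algorithm. -/
theorem mdifferentiableAt_deCasteljau {g : ℝ → M → M → M} {s : ℝ} {K : ℕ} {y : N → ℕ → M}
    {z₀ : N} (hy : ∀ l, MDifferentiableAt I J (fun z => y z l) z₀)
    (hg : ∀ k l : ℕ, k + l < K → MDifferentiableAt (J.prod J) J
      (fun q : M × M => g s q.1 q.2)
      (deCasteljau g s (y z₀) k l, deCasteljau g s (y z₀) k (l + 1))) :
    ∀ k l : ℕ, k + l ≤ K → MDifferentiableAt I J (fun z => deCasteljau g s (y z) k l) z₀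
  | 0, l, _ => hy l
  | k + 1, l, hkl =>
    (hg k l (by omega)).comp z₀
      ((mdifferentiableAt_deCasteljau hy hg k l (by omega)).prodMk
        (mdifferentiableAt_deCasteljau hy hg k (l + 1) (by omega)))

/-- The parameter manifold `N` is left free: it is `M` when one point moves and `M × M` when $p_i$
and $b_i^+$ move independently. -/
theorem mdifferentiableAt_bezier {g : ℝ → M → M → M} {s : ℝ} {K : ℕ} {y : ℕ → M}
    (hg : ∀ k l : ℕ, k + l < K → MDifferentiableAt (J.prod J) J (fun q : M × M => g s q.1 q.2)
      (deCasteljau g s y k l, deCasteljau g s y k (l + 1)))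
    {u : N → ℕ → M} {z₀ : N} (hu : ∀ l, MDifferentiableAt I J (fun z => u z l) z₀)
    (hu₀ : u z₀ = y) : MDifferentiableAt I J (fun z => bezier g K s (u z)) z₀ := by
  subst hu₀
  exact mdifferentiableAt_deCasteljau hu hg K 0 le_rfl

theorem mdifferentiableAt_update_apply {ι : Type*} [DecidableEq ι]
    {u : N → ι → M} {f : N → M} {a : ι} {z₀ : N}
    (hu : ∀ l, MDifferentiableAt I J (fun z => u z l) z₀) (hf : MDifferentiableAt I J f z₀)
    (l : ι) : MDifferentiableAt I J (fun z => Function.update (u z) a (f z) l) z₀ := by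
  by_cases h : l = a
  · subst h
    simpa using hf
  · simpa [Function.update_of_ne h] using hu l

end DeCasteljau

/-! ### Updates of control points, seen from a single segment. -/

section ControlPoints

variable {M : Type*}

/-- The name of the `j`-th control point of segment `i`. -/
def segmentLabel (K i j : ℕ) : CtrlLabel :=
  if j = 0 then .node i else if j = K then .node (i + 1) else .inner i j

theorem segmentPoints_eq (K : ℕ) (c : CtrlLabel → M) (i : ℕ) :
    segmentPoints K c i = fun j => c (segmentLabel K i j) := by
  funext j
  unfold segmentPoints segmentLabel
  split_ifs <;> rfl

/-- Indices beyond `K` keep distinct inner names, so this holds on all of `ℕ` and updates commute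
with restriction to a segment. -/
theorem segmentLabel_injective (K i : ℕ) : Function.Injective (segmentLabel K i) := by
  intro j j' h
  unfold segmentLabel at h
  split_ifs at h <;> simp_all

theorem segmentPoints_update_label (K : ℕ) (c : CtrlLabel → M) (i j : ℕ) (z : M)
    {x : CtrlLabel} (hx : segmentLabel K i j = x) :
    segmentPoints K (Function.update c x z) i = Function.update (segmentPoints K c i) j z := by
  subst hx
  rw [segmentPoints_eq, segmentPoints_eq]
  exact Function.update_comp_eq_of_injective' c (segmentLabel_injective K i) j z

theorem segmentPoints_update_of_forall_ne (K : ℕ) (c : CtrlLabel → M) (i : ℕ) (z : M)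
    {x : CtrlLabel} (hx : ∀ j, segmentLabel K i j ≠ x) :
    segmentPoints K (Function.update c x z) i = segmentPoints K c i := by
  rw [segmentPoints_eq, segmentPoints_eq]
  exact Function.update_comp_eq_of_forall_ne' c z hx

theorem segmentLabel_ne_inner {K k i j : ℕ} (h : k ≠ i) (l : ℕ) :
    segmentLabel K k l ≠ .inner i j := by
  unfold segmentLabel
  split_ifs <;> simp [h]

theorem segmentLabel_ne_node {K k i : ℕ} (h : k ≠ i) (h' : k + 1 ≠ i) (l : ℕ) :
    segmentLabel K k l ≠ .node i := by
  unfold segmentLabel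
  split_ifs <;> simp [h, h']

theorem segmentLabel_zero (K i : ℕ) : segmentLabel K i 0 = .node i := by
  simp [segmentLabel]

theorem segmentLabel_self {K : ℕ} (hK : 3 ≤ K) (i : ℕ) : segmentLabel K i K = .node (i + 1) := by
  rw [segmentLabel, if_neg (by omega), if_pos rfl]

theorem segmentLabel_of_inner {K j : ℕ} (h0 : j ≠ 0) (h : j ≠ K) (i : ℕ) :
    segmentLabel K i j = .inner i j := by
  simp [segmentLabel, h0, h]

/-! ### Response of the $C^1$ substitution to moving one control point. -/

variable {g : ℝ → M → M → M} {n K i : ℕ}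

theorem enforceC1_plus (h1 : 1 ≤ i) (hn : i < n) (c : CtrlLabel → M) :
    enforceC1 g n K c (.plus i) = g 2 (c (.minus K i)) (c (.node i)) := by
  simp [enforceC1, h1, hn]

theorem enforceC1_minus (hK : 3 ≤ K) (c : CtrlLabel → M) :
    enforceC1 g n K c (.minus K i) = c (.minus K i) := by
  simp only [enforceC1]
  rw [if_neg (by omega)]

/-- The substituted values read only points $b_l^-$ and $p_l$; since $K-1\ne 1$, none of these is a
$b_i^+$. -/
theorem enforceC1_update_plus (hK : 3 ≤ K) (h1 : 1 ≤ i) (hn : i < n) (c : CtrlLabel → M)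
    (z : M) : enforceC1 g n K (Function.update c (.plus i) z) = enforceC1 g n K c := by
  have hK1 : K - 1 ≠ 1 := by omega
  funext x
  cases x with
  | node l => simp [enforceC1]
  | inner l j =>
    simp only [enforceC1]
    split_ifs with h
    · simp [hK1]
    · refine Function.update_of_ne ?_ _ _
      rintro ⟨⟩
      exact h ⟨h1, hn, rfl⟩

theorem enforceC1_update_minus (hK : 3 ≤ K) (h1 : 1 ≤ i) (hn : i < n) (c : CtrlLabel → M)
    (z : M) : enforceC1 g n K (Function.update c (.minus K i) z) =
      Function.update (Function.update (enforceC1 g n K c) (.minus K i) z) (.plus i)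
        (g 2 z (c (.node i))) := by
  have hK1 : K - 1 ≠ 1 := by omega
  funext x
  cases x with
  | node l => simp [enforceC1]
  | inner l j =>
    by_cases hx : l = i ∧ j = 1
    · obtain ⟨rfl, rfl⟩ := hx
      simp [enforceC1, h1, hn]
    · have hx' : CtrlLabel.inner l j ≠ .plus i := by simpa using hx
      rw [Function.update_of_ne hx']
      simp only [enforceC1]
      split_ifs with h
      · obtain ⟨hl, hl', rfl⟩ := h
        -- As `l` and `i` are both positive, the truncated `l - 1 = i - 1` would force `l = i`,
        -- which is excluded here.
        have e1 : CtrlLabel.minus K l ≠ .minus K i := by simp; omega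
        have e2 : CtrlLabel.inner l 1 ≠ .minus K i := by simp; omega
        rw [Function.update_of_ne e1, Function.update_of_ne (by simp), Function.update_of_ne e2]
        simp [enforceC1, hl, hl']
      · simp only [Function.update_apply]
        split_ifs
        · rfl
        · simp [enforceC1, h]

theorem enforceC1_update_node (h1 : 1 ≤ i) (hn : i < n) (c : CtrlLabel → M)
    (z : M) : enforceC1 g n K (Function.update c (.node i) z) =
      Function.update (Function.update (enforceC1 g n K c) (.node i) z) (.plus i)
        (g 2 (c (.minus K i)) z) := by
  funext x
  cases x with
  | node l => by_cases h : l = i <;> simp [enforceC1, h]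
  | inner l j =>
    by_cases hx : l = i ∧ j = 1
    · obtain ⟨rfl, rfl⟩ := hx
      simp [enforceC1, h1, hn]
    · have hx' : CtrlLabel.inner l j ≠ .plus i := by simpa using hx
      rw [Function.update_of_ne hx', Function.update_of_ne (by simp)]
      simp only [enforceC1]
      split_ifs with h
      · have e1 : CtrlLabel.node l ≠ .node i := by
          simp only [ne_eq, CtrlLabel.node.injEq]
          rintro rfl
          exact hx ⟨rfl, h.2.2⟩
        rw [Function.update_of_ne (by simp), Function.update_of_ne e1]
      · rw [Function.update_of_ne (by simp)]

theorem enforceC1_apply_of_ne {x : CtrlLabel} (hx : ∀ i : ℕ, 1 ≤ i → i < n → x ≠ .plus i)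
    (c : CtrlLabel → M) : enforceC1 g n K c x = c x := by
  cases x with
  | node l => rfl
  | inner l j =>
    simp only [enforceC1]
    refine if_neg ?_
    rintro ⟨h1, h2, rfl⟩
    exact hx l h1 h2 rfl

theorem enforceC1_update_of_ne {x : CtrlLabel}
    (hx : ∀ i : ℕ, 1 ≤ i → i < n → x ≠ .plus i ∧ x ≠ .minus K i ∧ x ≠ .node i)
    (c : CtrlLabel → M) (z : M) :
    enforceC1 g n K (Function.update c x z) = Function.update (enforceC1 g n K c) x z := by
  funext x'
  by_cases h : x' = x
  · subst h
    rw [enforceC1_apply_of_ne (fun i h1 h2 => (hx i h1 h2).1)]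
    simp
  · rw [Function.update_of_ne h]
    cases x' with
    | node l => simp [enforceC1, Function.update_of_ne h]
    | inner l j =>
      simp only [enforceC1]
      split_ifs with hl
      · have := hx l hl.1 hl.2.1
        rw [Function.update_of_ne this.2.1.symm, Function.update_of_ne this.2.2.symm]
      · rw [Function.update_of_ne h]

end ControlPoints

/-! ### Segment numbers and half-open intervals. -/

section SegmentIndex

theorem segmentIndex_eq_of_mem {i : ℕ} {t : ℝ} (ht : t ∈ Ioc (i : ℝ) (i + 1)) :
    segmentIndex t = i := by
  have : ⌈t⌉₊ = i + 1 := by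
    rw [Nat.ceil_eq_iff (by omega)]
    simpa using ht
  rw [segmentIndex, this, Nat.add_sub_cancel]

/-- Positivity is essential: by truncated subtraction `t = 0` also has index `0`, without lying in
$(0,1]$. -/
theorem mem_of_segmentIndex_eq {i : ℕ} {t : ℝ} (h0 : 0 < t) (h : segmentIndex t = i) :
    t ∈ Ioc (i : ℝ) (i + 1) := by
  have hp : 0 < ⌈t⌉₊ := Nat.ceil_pos.2 h0
  have : ⌈t⌉₊ = i + 1 := by
    unfold segmentIndex at h
    omega
  rw [Nat.ceil_eq_iff (by omega)] at this
  simpa using this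

theorem segmentIndex_zero : segmentIndex 0 = 0 := by
  simp [segmentIndex]

theorem segmentIndex_eq_pred {i : ℕ} (hi : 1 ≤ i) {t : ℝ}
    (ht : t ∈ Ioc ((i : ℝ) - 1) i ∨ (i = 1 ∧ t = 0)) : segmentIndex t = i - 1 := by
  rcases ht with ht | ⟨rfl, rfl⟩
  · exact segmentIndex_eq_of_mem (by rw [Nat.cast_sub hi]; simpa using ht)
  · exact segmentIndex_zero

theorem mem_of_segmentIndex_eq_pred {i : ℕ} (hi : 1 ≤ i) {t : ℝ} (h0 : 0 ≤ t)
    (h : segmentIndex t = i - 1) : t ∈ Ioc ((i : ℝ) - 1) i ∨ (i = 1 ∧ t = 0) := by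
  rcases h0.eq_or_lt with rfl | h0
  · by_cases h1 : i = 1
    · exact Or.inr ⟨h1, rfl⟩
    · rw [segmentIndex_zero] at h
      omega
  · have := mem_of_segmentIndex_eq h0 h
    rw [Nat.cast_sub hi] at this
    exact Or.inl (by simpa using this)

end SegmentIndex

/-! ### The differentials of the constrained curve. -/

theorem lemma3p6 {m : ℕ} {M : Type*} [MetricSpace M]
    [ChartedSpace (EuclideanSpace ℝ (Fin m)) M] [IsManifold (𝓡 m) ∞ M]
    [RiemannianBundle (fun x : M => TangentSpace (𝓡 m) x)]
    [IsContMDiffRiemannianBundle (𝓡 m) ∞ (EuclideanSpace ℝ (Fin m))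
      (fun x : M => TangentSpace (𝓡 m) x)]
    [IsRiemannianManifold (𝓡 m) M] [CompleteSpace M]
    (g : ℝ → M → M → M) (hg : ∀ a b : M, IsShortestGeodesic a b (fun t => g t a b))
    (n K : ℕ) (hK : 3 ≤ K) (c : CtrlLabel → M) (c' : CtrlLabel → M)
    (hc' : c' = enforceC1 g n K c) (t : ℝ) (ht : t ∈ Icc (0 : ℝ) n)
    -- `g(2; ·, ·)` is differentiable at the pairs `(b_i^-, p_i)`
    (hg2 : ∀ i : ℕ, 1 ≤ i → i < n →
      MDifferentiableAt ((𝓡 m).prod (𝓡 m)) (𝓡 m) (fun q : M × M => g 2 q.1 q.2)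
        (c (.minus K i), c (.node i)))
    -- `g(s; ·, ·)`, with `s` the local time of `t`, is differentiable at the pairs to which
    -- the De Casteljau algorithm applies it
    (hgt : ∀ k l : ℕ, k + l < K →
      MDifferentiableAt ((𝓡 m).prod (𝓡 m)) (𝓡 m)
        (fun q : M × M => g (t - segmentIndex t) q.1 q.2)
        (deCasteljau g (t - segmentIndex t) (segmentPoints K c' (segmentIndex t)) k l,
          deCasteljau g (t - segmentIndex t) (segmentPoints K c' (segmentIndex t)) k (l + 1))) :
    -- all differentials of the Bézier segment to which `t` belongs exist
    (∀ j ≤ K, MDifferentiableAt (𝓡 m) (𝓡 m)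
      (fun z : M => bezier g K (t - segmentIndex t)
        (Function.update (segmentPoints K c' (segmentIndex t)) j z))
      (segmentPoints K c' (segmentIndex t) j)) ∧
    -- the variables `b_i^+` are eliminated
    (∀ i : ℕ, 1 ≤ i → i < n → ∀ z : M,
      compositeBezierC1 g n K (Function.update c (.plus i) z) t = compositeBezierC1 g n K c t) ∧
    -- the differential with respect to `b_i^-`
    (∀ i : ℕ, 1 ≤ i → i < n →
      ((t ∈ Ioc ((i : ℝ) - 1) i ∨ (i = 1 ∧ t = 0)) →
        HasPartialDiffAt (fun b => compositeBezierC1 g n K b t) c (.minus K i)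
          (partialDiff (m := m) (bezier g K (t - i + 1)) (segmentPoints K c' (i - 1)) (K - 1))) ∧
      (t ∈ Ioc (i : ℝ) (i + 1) →
        HasPartialDiffAt (fun b => compositeBezierC1 g n K b t) c (.minus K i)
          ((partialDiff (m := m) (bezier g K (t - i)) (segmentPoints K c' i) 1).comp
            (mfderiv (𝓡 m) (𝓡 m) (fun z : M => g 2 z (c (.node i))) (c (.minus K i))))) ∧
      (¬ (t ∈ Ioc ((i : ℝ) - 1) i ∨ (i = 1 ∧ t = 0)) → t ∉ Ioc (i : ℝ) (i + 1) →
        HasPartialDiffAt (m := m) (fun b => compositeBezierC1 g n K b t) c (.minus K i) 0)) ∧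
    -- the differential with respect to `p_i`
    (∀ i : ℕ, 1 ≤ i → i < n →
      ((t ∈ Ioc ((i : ℝ) - 1) i ∨ (i = 1 ∧ t = 0)) →
        HasPartialDiffAt (fun b => compositeBezierC1 g n K b t) c (.node i)
          (partialDiff (m := m) (bezier g K (t - i + 1)) (segmentPoints K c' (i - 1)) K)) ∧
      (t ∈ Ioc (i : ℝ) (i + 1) →
        ∃ D, HasPartialDiffAt (fun b => compositeBezierC1 g n K b t) c (.node i) D ∧
          ∀ η : TangentSpace (𝓡 m) (c (.node i)),
            D η = partialDiff (m := m) (bezier g K (t - i)) (segmentPoints K c' i) 0 η +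
              partialDiff (m := m) (bezier g K (t - i)) (segmentPoints K c' i) 1
                (mfderiv (𝓡 m) (𝓡 m) (fun z : M => g 2 (c (.minus K i)) z) (c (.node i)) η)) ∧
      (¬ (t ∈ Ioc ((i : ℝ) - 1) i ∨ (i = 1 ∧ t = 0)) → t ∉ Ioc (i : ℝ) (i + 1) →
        HasPartialDiffAt (m := m) (fun b => compositeBezierC1 g n K b t) c (.node i) 0)) ∧
    -- all other differentials are those of the unconstrained composite Bézier curve
    (∀ x : CtrlLabel,
      (∀ i : ℕ, 1 ≤ i → i < n → x ≠ .plus i ∧ x ≠ .minus K i ∧ x ≠ .node i) →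
        HasPartialDiffAt (fun b => compositeBezierC1 g n K b t) c x
          (partialDiff (m := m) (fun b => compositeBezier g K b t) c' x)) := by

  subst hc'
  have hseg : ∀ {u : M → ℕ → M} {z₀ : M},
      (∀ l, MDifferentiableAt (𝓡 m) (𝓡 m) (fun z => u z l) z₀) →
      u z₀ = segmentPoints K (enforceC1 g n K c) (segmentIndex t) →
      MDifferentiableAt (𝓡 m) (𝓡 m) (fun z => bezier g K (t - segmentIndex t) (u z)) z₀ :=
    fun hu hu₀ => mdifferentiableAt_bezier hgt hu hu₀
  have hpart : ∀ j, MDifferentiableAt (𝓡 m) (𝓡 m)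
      (fun z : M => bezier g K (t - segmentIndex t)
        (Function.update (segmentPoints K (enforceC1 g n K c) (segmentIndex t)) j z))
      (segmentPoints K (enforceC1 g n K c) (segmentIndex t) j) := fun j =>
    hseg (fun l => mdifferentiableAt_update_apply (fun _ => mdifferentiableAt_const)
      mdifferentiableAt_id l) (Function.update_eq_self _ _)
  have hpred : ∀ i : ℕ, 1 ≤ i → segmentIndex t = i - 1 →
      t - (segmentIndex t : ℝ) = t - i + 1 := by
    intro i h1 h
    rw [h, Nat.cast_sub h1]
    push_cast
    ring
  refine ⟨fun j _ => hpart j, ?_, ?_, ?_, ?_⟩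
  · intro i h1 hn z
    simp only [compositeBezierC1, enforceC1_update_plus hK h1 hn]
  · intro i h1 hn
    have hfun : ∀ z, compositeBezierC1 g n K (Function.update c (.minus K i) z) t =
        bezier g K (t - segmentIndex t) (segmentPoints K
          (Function.update (Function.update (enforceC1 g n K c) (.minus K i) z) (.plus i)
            (g 2 z (c (.node i)))) (segmentIndex t)) := by
      intro z
      rw [compositeBezierC1, enforceC1_update_minus hK h1 hn, compositeBezier]
    refine ⟨fun hti => ?_, fun hti => ?_, fun hti hti' => ?_⟩
    · have hs := segmentIndex_eq_pred h1 hti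
      -- In segment `i - 1` the point $b_i^-$ has index `K - 1`, and the induced change of $b_i^+$
      -- is invisible.
      have hD := (hpart (K - 1)).hasMFDerivAt
      rw [hpred i h1 hs, hs] at hD
      refine hD.congr_base ?_ ?_
      · funext z
        refine Eq.trans ?_ (hfun z).symm
        rw [hpred i h1 hs, hs,
          segmentPoints_update_of_forall_ne _ _ _ _ (segmentLabel_ne_inner (by omega)),
          segmentPoints_update_label _ _ _ (K - 1) _
            (segmentLabel_of_inner (by omega) (by omega) _)]
      · rw [segmentPoints_eq]
        dsimp only
        rw [segmentLabel_of_inner (by omega) (by omega)]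
        exact enforceC1_minus hK c
    · have hs := segmentIndex_eq_of_mem hti
      have hy : segmentPoints K (enforceC1 g n K c) i 1 = g 2 (c (.minus K i)) (c (.node i)) := by
        rw [segmentPoints_eq]
        dsimp only
        rw [segmentLabel_of_inner (by omega) (by omega)]
        exact enforceC1_plus h1 hn c
      -- In segment `i` only $b_i^+$, at index `1`, moves; the differential factors through that of
      -- `g 2`.
      have hD := (hpart 1).hasMFDerivAt
      rw [hs] at hD
      have hg2' : MDifferentiableAt (𝓡 m) (𝓡 m) (fun z : M => g 2 z (c (.node i)))
          (c (.minus K i)) :=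
        (hg2 i h1 hn).comp (c (.minus K i)) (mdifferentiableAt_id.prodMk mdifferentiableAt_const)
      have hD' := HasMFDerivAt.congr_base (m := m) hD rfl hy
      refine (hD'.comp (c (.minus K i)) hg2'.hasMFDerivAt).congr_base ?_ rfl
      funext z
      refine Eq.trans ?_ (hfun z).symm
      rw [hs, segmentPoints_update_label _ _ _ 1 _
          (segmentLabel_of_inner (by omega) (by omega) _),
        segmentPoints_update_of_forall_ne _ _ _ _ (segmentLabel_ne_inner (by omega))]
      rfl
    · have hs : segmentIndex t ≠ i - 1 := fun h =>
        hti (mem_of_segmentIndex_eq_pred h1 ht.1 h)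
      have hs' : segmentIndex t ≠ i := by
        intro h
        -- At `t = 0` the index is `0`, which differs from `i` because `1 ≤ i`.
        rcases ht.1.eq_or_lt with h0 | h0
        · rw [← h0, segmentIndex_zero] at h
          omega
        · exact hti' (mem_of_segmentIndex_eq h0 h)
      refine HasMFDerivAt.congr_base (m := m) (hasMFDerivAt_const (bezier g K (t - segmentIndex t)
        (segmentPoints K (enforceC1 g n K c) (segmentIndex t))) (c (.minus K i))) ?_ rfl
      funext z
      refine Eq.trans ?_ (hfun z).symm
      rw [segmentPoints_update_of_forall_ne _ _ _ _ (segmentLabel_ne_inner hs'),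
        segmentPoints_update_of_forall_ne _ _ _ _ (segmentLabel_ne_inner hs)]
  · intro i h1 hn
    have hfun : ∀ z, compositeBezierC1 g n K (Function.update c (.node i) z) t =
        bezier g K (t - segmentIndex t) (segmentPoints K
          (Function.update (Function.update (enforceC1 g n K c) (.node i) z) (.plus i)
            (g 2 (c (.minus K i)) z)) (segmentIndex t)) := by
      intro z
      rw [compositeBezierC1, enforceC1_update_node h1 hn, compositeBezier]
    refine ⟨fun hti => ?_, fun hti => ?_, fun hti hti' => ?_⟩
    · have hs := segmentIndex_eq_pred h1 hti
      have hlab : segmentLabel K (i - 1) K = .node i := by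
        rw [segmentLabel_self hK, Nat.sub_add_cancel h1]
      have hD := (hpart K).hasMFDerivAt
      rw [hpred i h1 hs, hs] at hD
      refine hD.congr_base ?_ ?_
      · funext z
        refine Eq.trans ?_ (hfun z).symm
        rw [hpred i h1 hs, hs,
          segmentPoints_update_of_forall_ne _ _ _ _ (segmentLabel_ne_inner (by omega)),
          segmentPoints_update_label _ _ _ K _ hlab]
      · rw [segmentPoints_eq]
        dsimp only
        rw [hlab]
        rfl
    · have hs := segmentIndex_eq_of_mem hti
      have hy : segmentPoints K (enforceC1 g n K c) i 1 = g 2 (c (.minus K i)) (c (.node i)) := by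
        rw [segmentPoints_eq]
        dsimp only
        rw [segmentLabel_of_inner (by omega) (by omega)]
        exact enforceC1_plus h1 hn c
      have hg2' : MDifferentiableAt (𝓡 m) (𝓡 m) (fun z : M => g 2 (c (.minus K i)) z)
          (c (.node i)) :=
        (hg2 i h1 hn).comp (c (.node i)) (mdifferentiableAt_const.prodMk mdifferentiableAt_id)
      rw [hs] at hgt
      -- Points `0` and `1` of segment `i` are freed independently; the constraint tying $b_i^+$ to
      -- $p_i$ enters only through `h` below.
      have hF : MDifferentiableAt ((𝓡 m).prod (𝓡 m)) (𝓡 m)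
          (fun q : M × M => bezier g K (t - i) (Function.update (Function.update
            (segmentPoints K (enforceC1 g n K c) i) 0 q.1) 1 q.2))
          (segmentPoints K (enforceC1 g n K c) i 0, segmentPoints K (enforceC1 g n K c) i 1) :=
        mdifferentiableAt_bezier hgt
          (fun l => mdifferentiableAt_update_apply
            (fun l => mdifferentiableAt_update_apply (fun _ => mdifferentiableAt_const)
              mdifferentiableAt_fst l) mdifferentiableAt_snd l)
          (by simp)
      obtain ⟨D, hD, hDη⟩ := hasMFDerivAt_update_update (m := m) zero_ne_one hF
        (h := fun z => g 2 (c (.minus K i)) z) hg2' hy.symm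
      refine ⟨D, hD.congr_base ?_ rfl, hDη⟩
      funext z
      refine Eq.trans ?_ (hfun z).symm
      rw [hs, segmentPoints_update_label _ _ _ 1 _
          (segmentLabel_of_inner (by omega) (by omega) _),
        segmentPoints_update_label _ _ _ 0 _ (segmentLabel_zero K i)]
    · have hs : segmentIndex t ≠ i - 1 := fun h =>
        hti (mem_of_segmentIndex_eq_pred h1 ht.1 h)
      have hs' : segmentIndex t ≠ i := by
        intro h
        rcases ht.1.eq_or_lt with h0 | h0
        · rw [← h0, segmentIndex_zero] at h
          omega
        · exact hti' (mem_of_segmentIndex_eq h0 h)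
      refine HasMFDerivAt.congr_base (m := m) (hasMFDerivAt_const (bezier g K (t - segmentIndex t)
        (segmentPoints K (enforceC1 g n K c) (segmentIndex t))) (c (.node i))) ?_ rfl
      funext z
      refine Eq.trans ?_ (hfun z).symm
      rw [segmentPoints_update_of_forall_ne _ _ _ _ (segmentLabel_ne_inner hs'),
        segmentPoints_update_of_forall_ne _ _ _ _ (segmentLabel_ne_node hs' (by omega))]
  · intro x hx
    have hdiff : MDifferentiableAt (𝓡 m) (𝓡 m)
        (fun z : M => compositeBezier g K (Function.update (enforceC1 g n K c) x z) t)
        (enforceC1 g n K c x) := by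
      refine hseg (u := fun z => segmentPoints K (Function.update (enforceC1 g n K c) x z)
        (segmentIndex t)) (fun l => ?_) ?_
      -- Each point of the segment is constant or equal to `z`, so whether `x` belongs to the
      -- segment need not be decided.
      · simp only [segmentPoints_eq]
        exact mdifferentiableAt_update_apply (fun _ => mdifferentiableAt_const)
          mdifferentiableAt_id _
      · rw [Function.update_eq_self]
    refine HasMFDerivAt.congr_base (m := m) hdiff.hasMFDerivAt ?_
      (enforceC1_apply_of_ne (fun i h1 h2 => (hx i h1 h2).1) c)
    funext z
    simp only [compositeBezierC1, enforceC1_update_of_ne hx]
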